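/- Let $\mathbb D=\{z\in\mathbb C:|z|<1\}$ and $\mathbb T=\partial\mathbb D$. For $\alpha>-1$ let $A^2_\alpha$ be the weighted Bergman space of all functions $f$ holomorphic in $\mathbb D$ with $$\|f\|_\alpha^2=(\alpha+1)\int_{\mathbb D}|f(z)|^2(1-|z|^2)^\alpha\,dA(z)<\infty,$$ where $dA$ is Lebesgue measure divided by $\pi$. For an integer $N\ge 1$ let $$SF^N(\mathbb T)=\Big\{\sum_{0\le k<n}\frac1{(z-a_k)^N}\;:\;n\ge 1,\ a_0,\dots,a_{n-1}\in\mathbb T\Big\},$$ where the $a_k$ need not be distinct. **Theorem.** Let $N\ge 2$ be an integer and $\alpha_*=2(N-1)+1=2N-1$. Then $SF^N(\mathbb T)\subset A^2_\alpha$ for every real $\alpha>2(N-1)$, and, with respect to the norm topology of $A^2_\alpha$: 1. if $2(N-1)<\alpha<\alpha_*$, then $SF^N(\mathbb T)$ is nowhere dense in $A^2_\alpha$; 2. if $\alpha=\alpha_*$, then $SF^N(\mathbb T)$ is not dense in $A^2_\alpha$; 3. if $\alpha>\alpha_*+1$, then $SF^N(\mathbb T)$ is dense in $A^2_\alpha$.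 -/

import Mathlib

open MeasureTheory

noncomputable section

/-- The probability measure `dA_α = (α + 1) (1 - |z|²)^α dA` on the open unit disc (for `α > -1`),
where `dA` is Lebesgue measure divided by `π`; seen as a measure on `ℂ` carried by the disc. -/
def bergmanMeasure (α : ℝ) : Measure ℂ :=
  (volume.restrict (Metric.ball (0 : ℂ) 1)).withDensity
    (fun z => ENNReal.ofReal ((α + 1) / Real.pi * (1 - ‖z‖ ^ 2) ^ α))

/-- The weighted Bergman space `A²_α` of the unit disc: the elements of `L²(dA_α)` that are
represented by a function holomorphic in the disc, with the `L²(dA_α)` norm. (For `α > -1` the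
representative is unique on the disc, as `dA_α` has a positive density there.) -/
def bergmanSpace (α : ℝ) : Submodule ℂ (Lp ℂ 2 (bergmanMeasure α)) where
  carrier := {f | ∃ F : ℂ → ℂ, DifferentiableOn ℂ F (Metric.ball 0 1) ∧
    (f : ℂ → ℂ) =ᵐ[bergmanMeasure α] F}
  add_mem' := by
    rintro f g ⟨F, hF, hfF⟩ ⟨G, hG, hgG⟩
    exact ⟨F + G, hF.add hG, (Lp.coeFn_add f g).trans (hfF.add hgG)⟩
  zero_mem' := ⟨0, differentiableOn_const 0, Lp.coeFn_zero ℂ 2 (bergmanMeasure α)⟩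
  smul_mem' := by
    rintro c f ⟨F, hF, hfF⟩
    exact ⟨c • F, hF.const_smul c, (Lp.coeFn_smul c f).trans (hfF.const_smul c)⟩

/-- `SF^N(E)`: the functions `∑_{0 ≤ k < n} 1 / (z - a_k)^N`, with `n ≥ 1` and poles `a_k ∈ E`,
not necessarily distinct. -/
def simplePartialFractions (N : ℕ) (E : Set ℂ) : Set (ℂ → ℂ) :=
  {g | ∃ n : ℕ, 1 ≤ n ∧ ∃ a : Fin n → ℂ, (∀ k, a k ∈ E) ∧
    g = fun z => ∑ k, 1 / (z - a k) ^ N}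

/-- `SF^N(𝕋)` as a subset of `A²_α`. -/
def bergmanFractions (N : ℕ) (α : ℝ) : Set (bergmanSpace α) :=
  {f | ∃ g ∈ simplePartialFractions N (Metric.sphere (0 : ℂ) 1),
    ((f : Lp ℂ 2 (bergmanMeasure α)) : ℂ → ℂ) =ᵐ[bergmanMeasure α] g}

/-- `α_* = 2 (N - 1) + 1`. -/
def criticalExponent (N : ℕ) : ℝ := 2 * ((N : ℝ) - 1) + 1

end

/-! Write `N = M + 1` and `s = α - 2M`. By Parseval on circles, the squared norm in `A²_α` is the
sum of `|c_k|² ω_k` over Taylor coefficients, with moments `ω_k` of order `(k+1)^(-(α+1))`. The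
coefficients of a sum of `n` fractions are, up to sign, `choose (k+M) M * p_{k+M+1}`, where `p_m` is
the sum of the `a_j^(-m)`. Hence its squared norm is comparable to the sum of `|p_{k+M+1}|²
(k+1)^(-(s+1))`. Since `|p_m| ≤ n`, this is finite for `s > 0`.

Obstruction (`exists_le_norm_fraction_sq`): the Abel sum of `r^m |p_m|²` is a double sum of `1/(1 -
r w)` with `|w| = 1`. All its terms have positive real part and the diagonal gives `n/(1-r)`. Taking
`1 - r` of order `1/n` bounds the squared norm below by a multiple of `n^(1-s)`. For `s = 1` the
fractions therefore avoid a ball about `0`. For `s < 1` a bound on the norm bounds `n`, hence every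
`p_m`, so nearby fractions cannot differ by a monomial of high degree and fixed norm.

Density (`exists_tendsto_fractionCoeff`): move the `n`-th roots of unity by angles `u/n`, with `u` a
real trigonometric polynomial. As `n → ∞`, `p_m` tends to `-i m` times the `m`-th Fourier
coefficient of `u`, so any finite segment of coefficients can be reached, while `|p_m| = O(m)`
uniformly in `n`. For `s > 2` this bound is square summable against the weights, and dominated
convergence gives convergence in norm. -/

/-! ### Parseval's identity on the circle -/

theorem integral_exp_int_mul_I (m : ℤ) :
    ∫ θ in Set.Ioc (-Real.pi) Real.pi, Complex.exp (m * (θ * Complex.I)) =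
      if m = 0 then (2 * Real.pi : ℂ) else 0 := by
  have hpi : -Real.pi ≤ Real.pi := by linarith [Real.pi_pos]
  rw [← intervalIntegral.integral_of_le hpi]
  split_ifs with h
  · subst h
    simp
    ring
  · have hc : (m : ℂ) * Complex.I ≠ 0 := by simp [h]
    have h1 : ∀ θ : ℝ, Complex.exp (m * (θ * Complex.I)) = Complex.exp ((m * Complex.I) * θ) := by
      intro θ; congr 1; ring
    simp_rw [h1]
    rw [integral_exp_mul_complex hc]
    have h2 : Complex.exp (m * Complex.I * (Real.pi : ℝ)) =
        Complex.exp (m * Complex.I * ((-Real.pi : ℝ) : ℂ)) := by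
      rw [Complex.exp_eq_exp_iff_exists_int]
      exact ⟨m, by push_cast; ring⟩
    rw [h2, sub_self, zero_div]

/-- Parseval's identity for absolutely convergent one-sided trigonometric series. -/
theorem hasSum_integral_norm_sq_fourier {b : ℕ → ℂ} (hb : Summable fun k => ‖b k‖) :
    HasSum (fun k => 2 * Real.pi * ‖b k‖ ^ 2)
      (∫ θ in Set.Ioc (-Real.pi) Real.pi,
        ‖∑' k, b k * Complex.exp (θ * Complex.I) ^ k‖ ^ 2) := by
  set e : ℕ → ℝ → ℂ := fun k θ => b k * Complex.exp (θ * Complex.I) ^ k with he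
  have hen : ∀ k θ, ‖e k θ‖ = ‖b k‖ := by
    intro k θ
    simp [he, Complex.norm_exp_ofReal_mul_I]
  set G : ℕ × ℕ → ℝ → ℂ := fun p θ => e p.1 θ * (starRingEnd ℂ) (e p.2 θ) with hG
  have hGn : ∀ p θ, ‖G p θ‖ = ‖b p.1‖ * ‖b p.2‖ := by
    intro p θ
    simp only [hG, norm_mul, RCLike.norm_conj, hen]
  have hcont : ∀ p, Continuous (G p) := by
    intro p
    simp only [hG, he]
    fun_prop
  have hs2 : Summable fun p : ℕ × ℕ => ‖b p.1‖ * ‖b p.2‖ := by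
    have := Summable.mul_norm hb hb
    simpa only [norm_mul] using this
  have hint : ∀ p, Integrable (G p) (volume.restrict (Set.Ioc (-Real.pi) Real.pi)) := fun p =>
    ((hcont p).integrableOn_Icc (a := -Real.pi) (b := Real.pi)).mono_set Set.Ioc_subset_Icc_self
  have key := hasSum_integral_of_summable_integral_norm hint (by
    simp only [hGn, integral_const]
    simpa using hs2.mul_left _)
  have hsum : ∀ θ, ∑' p, G p θ = ((‖∑' k, e k θ‖ ^ 2 : ℝ) : ℂ) := by
    intro θ
    have h1 : Summable fun k => ‖e k θ‖ := by simpa only [hen] using hb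
    have h2 : Summable fun k => ‖(starRingEnd ℂ) (e k θ)‖ := by
      simpa only [RCLike.norm_conj] using h1
    have h3 := tsum_mul_tsum_of_summable_norm h1 h2
    rw [← Complex.conj_tsum, Complex.mul_conj, Complex.normSq_eq_norm_sq] at h3
    exact h3.symm
  have hval : ∀ p : ℕ × ℕ, ∫ θ in Set.Ioc (-Real.pi) Real.pi, G p θ =
      if p.1 = p.2 then (2 * Real.pi * ‖b p.1‖ ^ 2 : ℂ) else 0 := by
    rintro ⟨k, l⟩
    have h1 : ∀ θ : ℝ, G (k, l) θ = (b k * (starRingEnd ℂ) (b l)) *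
        Complex.exp (((k : ℤ) - (l : ℤ) : ℤ) * (θ * Complex.I)) := by
      intro θ
      simp only [hG, he, map_mul, map_pow, ← Complex.exp_conj, Complex.conj_ofReal,
        Complex.conj_I]
      rw [← Complex.exp_nat_mul, ← Complex.exp_nat_mul, mul_mul_mul_comm, ← Complex.exp_add]
      congr 2
      push_cast
      ring
    simp_rw [h1]
    rw [integral_const_mul, integral_exp_int_mul_I]
    by_cases h : k = l
    · subst h
      simp only [sub_self, if_true]
      rw [Complex.mul_conj, Complex.normSq_eq_norm_sq]
      push_cast
      ring
    · rw [if_neg (by omega), if_neg h, mul_zero]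
  simp_rw [hval, hsum] at key
  rw [integral_complex_ofReal] at key
  have hinj : Function.Injective (fun k : ℕ => (k, k)) := fun a b h => (Prod.ext_iff.1 h).1
  rw [← hinj.hasSum_iff (by
    rintro ⟨k, l⟩ h
    rw [if_neg]
    intro hkl
    exact h ⟨k, Prod.ext rfl hkl⟩)] at key
  have := Complex.hasSum_re key
  simp only [Function.comp_def, if_true, Complex.ofReal_re] at this
  convert this using 2
  rename_i k
  have : (2 * Real.pi * ‖b k‖ ^ 2 : ℂ) = ((2 * Real.pi * ‖b k‖ ^ 2 : ℝ) : ℂ) := by push_cast; rfl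
  rw [this, Complex.ofReal_re]

/-! ### The Bergman integral in polar coordinates -/

/-- `F` is the sum on the unit disc of the power series with coefficients `c`. -/
def HasDiscSeries (c : ℕ → ℂ) (F : ℂ → ℂ) : Prop :=
  ∀ z : ℂ, ‖z‖ < 1 → HasSum (fun k => c k * z ^ k) (F z)

/-- The squared norm of `z ^ k` in `A²_α`. -/
noncomputable def bergmanMoment (α : ℝ) (k : ℕ) : ℝ :=
  ∫ r in Set.Ioo (0 : ℝ) 1, 2 * (α + 1) * r * (1 - r ^ 2) ^ α * (r ^ k) ^ 2

theorem HasDiscSeries.lintegral_circle {c : ℕ → ℂ} {F : ℂ → ℂ} (hF : HasDiscSeries c F)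
    {r : ℝ} (h0 : 0 ≤ r) (h1 : r < 1) :
    ∫⁻ θ in Set.Ioo (-Real.pi) Real.pi, ‖F (r * Complex.exp (θ * Complex.I))‖ₑ ^ 2 =
      ∑' k, ENNReal.ofReal (2 * Real.pi * (‖c k‖ ^ 2 * (r ^ k) ^ 2)) := by
  have hb : Summable fun k => ‖c k * (r : ℂ) ^ k‖ :=
    (hF r (by simpa [abs_of_nonneg h0] using h1)).summable.norm
  have hFr : ∀ θ : ℝ, F (r * Complex.exp (θ * Complex.I)) =
      ∑' k, c k * (r : ℂ) ^ k * Complex.exp (θ * Complex.I) ^ k := by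
    intro θ
    rw [← (hF (r * Complex.exp (θ * Complex.I)) (by
      simpa [Complex.norm_exp_ofReal_mul_I, abs_of_nonneg h0] using h1)).tsum_eq]
    simp_rw [mul_pow, mul_assoc]
  have hP := hasSum_integral_norm_sq_fourier hb
  have hcont : Continuous fun θ : ℝ =>
      ‖∑' k, c k * (r : ℂ) ^ k * Complex.exp (θ * Complex.I) ^ k‖ ^ 2 := by
    refine Continuous.pow (Continuous.norm ?_) 2
    refine continuous_tsum (fun k => by fun_prop) hb ?_
    intro k θ
    simp [Complex.norm_exp_ofReal_mul_I]
  have hint : IntegrableOn (fun θ : ℝ =>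
      ‖∑' k, c k * (r : ℂ) ^ k * Complex.exp (θ * Complex.I) ^ k‖ ^ 2)
      (Set.Ioc (-Real.pi) Real.pi) :=
    (hcont.integrableOn_Icc (a := -Real.pi) (b := Real.pi)).mono_set Set.Ioc_subset_Icc_self
  rw [Measure.restrict_congr_set Ioo_ae_eq_Ioc]
  have h2 : ∀ θ : ℝ, ‖F (r * Complex.exp (θ * Complex.I))‖ₑ ^ 2 = ENNReal.ofReal
      (‖∑' k, c k * (r : ℂ) ^ k * Complex.exp (θ * Complex.I) ^ k‖ ^ 2) := by
    intro θ
    rw [hFr, ENNReal.ofReal_pow (norm_nonneg _), ofReal_norm]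
  simp_rw [h2]
  rw [← ofReal_integral_eq_lintegral_ofReal hint (by filter_upwards with θ; positivity),
    ← hP.tsum_eq, ENNReal.ofReal_tsum_of_nonneg (fun k => by positivity) hP.summable]
  refine tsum_congr fun k => ?_
  rw [norm_mul, norm_pow, Complex.norm_real, Real.norm_of_nonneg h0, mul_pow]

theorem bergmanDensity_measurable (α : ℝ) :
    Measurable fun z : ℂ => ENNReal.ofReal ((α + 1) / Real.pi * (1 - ‖z‖ ^ 2) ^ α) := by
  fun_prop

theorem bergmanMeasure_absolutelyContinuous (α : ℝ) :
    bergmanMeasure α ≪ volume.restrict (Metric.ball (0 : ℂ) 1) :=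
  withDensity_absolutelyContinuous _ _

theorem aestronglyMeasurable_bergman {α : ℝ} {F : ℂ → ℂ}
    (hF : DifferentiableOn ℂ F (Metric.ball 0 1)) :
    AEStronglyMeasurable F (bergmanMeasure α) :=
  (hF.continuousOn.aestronglyMeasurable Metric.isOpen_ball.measurableSet).mono_ac
    (bergmanMeasure_absolutelyContinuous α)

theorem bergmanIntegrand_nonneg {α : ℝ} (hα : 0 < α) (k : ℕ) {r : ℝ} (hr : r ∈ Set.Ioo (0 : ℝ) 1) :
    0 ≤ 2 * (α + 1) * r * (1 - r ^ 2) ^ α * (r ^ k) ^ 2 := by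
  have : 0 ≤ 1 - r ^ 2 := by nlinarith [hr.1, hr.2]
  have := hr.1
  positivity

theorem bergmanIntegrand_continuous {α : ℝ} (hα : 0 < α) (k : ℕ) :
    Continuous fun r : ℝ => 2 * (α + 1) * r * (1 - r ^ 2) ^ α * (r ^ k) ^ 2 := by
  have : Continuous fun r : ℝ => (1 - r ^ 2) ^ α :=
    (by fun_prop : Continuous fun r : ℝ => 1 - r ^ 2).rpow_const fun _ => Or.inr hα.le
  fun_prop

theorem ofReal_bergmanMoment {α : ℝ} (hα : 0 < α) (k : ℕ) :
    ENNReal.ofReal (bergmanMoment α k) = ∫⁻ r in Set.Ioo (0 : ℝ) 1,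
      ENNReal.ofReal (2 * (α + 1) * r * (1 - r ^ 2) ^ α * (r ^ k) ^ 2) := by
  refine ofReal_integral_eq_lintegral_ofReal ?_ ?_
  · exact ((bergmanIntegrand_continuous hα k).integrableOn_Icc (a := 0) (b := 1)).mono_set
      Set.Ioo_subset_Icc_self
  · filter_upwards [ae_restrict_mem measurableSet_Ioo] with r hr
    exact bergmanIntegrand_nonneg hα k hr

theorem bergmanMoment_nonneg {α : ℝ} (hα : 0 < α) (k : ℕ) : 0 ≤ bergmanMoment α k :=
  setIntegral_nonneg measurableSet_Ioo fun _ hr => bergmanIntegrand_nonneg hα k hr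

/-- Polar coordinates, then Parseval on each circle. Working in `ENNReal` lets sum and integral be
exchanged with no integrability assumption, so the identity also serves to prove membership in the
space. -/
theorem HasDiscSeries.lintegral_bergman {α : ℝ} (hα : 0 < α) {c : ℕ → ℂ} {F : ℂ → ℂ}
    (hF : HasDiscSeries c F) (hd : DifferentiableOn ℂ F (Metric.ball 0 1)) :
    ∫⁻ z, ‖F z‖ₑ ^ 2 ∂bergmanMeasure α =
      ∑' k, ENNReal.ofReal (‖c k‖ ^ 2 * bergmanMoment α k) := by
  have hm := bergmanDensity_measurable α
  set d : ℂ → ENNReal := fun z => ENNReal.ofReal ((α + 1) / Real.pi * (1 - ‖z‖ ^ 2) ^ α) with hd'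
  have hball := Metric.isOpen_ball.measurableSet (s := Metric.ball (0 : ℂ) 1)
  have hFm : AEMeasurable (fun z => ‖F z‖ₑ ^ 2) (volume.restrict (Metric.ball (0 : ℂ) 1)) :=
    ((hd.continuousOn.aestronglyMeasurable hball).enorm).pow_const 2
  have e1 : ∫⁻ z, ‖F z‖ₑ ^ 2 ∂bergmanMeasure α =
      ∫⁻ z, (Metric.ball (0 : ℂ) 1).indicator (fun z => d z * ‖F z‖ₑ ^ 2) z := by
    rw [bergmanMeasure, lintegral_withDensity_eq_lintegral_mul₀ hm.aemeasurable hFm,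
      lintegral_indicator hball]
    rfl
  rw [e1, ← Complex.lintegral_comp_polarCoord_symm, polarCoord_target]
  have hsub : Set.Ioo (0 : ℝ) 1 ×ˢ Set.Ioo (-Real.pi) Real.pi ⊆
      Set.Ioi (0 : ℝ) ×ˢ Set.Ioo (-Real.pi) Real.pi :=
    Set.prod_mono Set.Ioo_subset_Ioi_self le_rfl
  have hpol : ∀ p : ℝ × ℝ, Complex.polarCoord.symm p = p.1 * Complex.exp (p.2 * Complex.I) := by
    intro p
    rw [Complex.polarCoord_symm_apply, Complex.exp_mul_I]
    push_cast
    rfl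
  have hnpol : ∀ p : ℝ × ℝ, 0 < p.1 → ‖(p.1 : ℂ) * Complex.exp (p.2 * Complex.I)‖ = p.1 := by
    intro p hp
    simp [Complex.norm_exp_ofReal_mul_I, abs_of_pos hp]
  have e2 : ∫⁻ p in Set.Ioi (0 : ℝ) ×ˢ Set.Ioo (-Real.pi) Real.pi, ENNReal.ofReal p.1 •
        (Metric.ball (0 : ℂ) 1).indicator (fun z => d z * ‖F z‖ₑ ^ 2) (Complex.polarCoord.symm p) =
      ∫⁻ p in Set.Ioo (0 : ℝ) 1 ×ˢ Set.Ioo (-Real.pi) Real.pi,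
        ENNReal.ofReal (p.1 * ((α + 1) / Real.pi * (1 - p.1 ^ 2) ^ α)) *
          ‖F (p.1 * Complex.exp (p.2 * Complex.I))‖ₑ ^ 2 := by
    rw [← lintegral_indicator (measurableSet_Ioi.prod measurableSet_Ioo),
      ← lintegral_indicator (measurableSet_Ioo.prod measurableSet_Ioo)]
    refine lintegral_congr fun p => ?_
    by_cases hp : p ∈ Set.Ioi (0 : ℝ) ×ˢ Set.Ioo (-Real.pi) Real.pi
    · have hp1 : 0 < p.1 := hp.1
      rw [Set.indicator_of_mem hp, hpol]
      by_cases hp2 : p.1 < 1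
      · rw [Set.indicator_of_mem (s := Set.Ioo (0 : ℝ) 1 ×ˢ _) ⟨⟨hp1, hp2⟩, hp.2⟩,
          Set.indicator_of_mem (by rwa [mem_ball_zero_iff, hnpol p hp1]), smul_eq_mul,
          ← mul_assoc, ENNReal.ofReal_mul hp1.le]
        simp only [hd', hnpol p hp1]
      · rw [Set.indicator_of_notMem (s := Set.Ioo (0 : ℝ) 1 ×ˢ _) (fun h => hp2 h.1.2),
          Set.indicator_of_notMem (by rwa [mem_ball_zero_iff, hnpol p hp1]), smul_zero]
    · rw [Set.indicator_of_notMem hp, Set.indicator_of_notMem fun h => hp (hsub h)]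
  have hcontF : ContinuousOn (fun p : ℝ × ℝ => F (p.1 * Complex.exp (p.2 * Complex.I)))
      (Set.Ioo (0 : ℝ) 1 ×ˢ Set.Ioo (-Real.pi) Real.pi) := by
    refine hd.continuousOn.comp (by fun_prop) ?_
    intro p hp
    rw [mem_ball_zero_iff, hnpol p hp.1.1]
    exact hp.1.2
  have hms : MeasurableSet (Set.Ioo (0 : ℝ) 1 ×ˢ Set.Ioo (-Real.pi) Real.pi) :=
    measurableSet_Ioo.prod measurableSet_Ioo
  have hmeas : AEMeasurable (fun p : ℝ × ℝ =>
      ENNReal.ofReal (p.1 * ((α + 1) / Real.pi * (1 - p.1 ^ 2) ^ α)) *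
        ‖F (p.1 * Complex.exp (p.2 * Complex.I))‖ₑ ^ 2)
      (volume.restrict (Set.Ioo (0 : ℝ) 1 ×ˢ Set.Ioo (-Real.pi) Real.pi)) :=
    (Measurable.aemeasurable (by fun_prop)).mul
      ((hcontF.aestronglyMeasurable hms).enorm.pow_const 2)
  rw [Measure.volume_eq_prod] at hmeas
  rw [e2, Measure.volume_eq_prod, setLIntegral_prod _ hmeas]
  have e3 : ∀ r ∈ Set.Ioo (0 : ℝ) 1, ∫⁻ θ in Set.Ioo (-Real.pi) Real.pi,
        ENNReal.ofReal (r * ((α + 1) / Real.pi * (1 - r ^ 2) ^ α)) *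
          ‖F (r * Complex.exp (θ * Complex.I))‖ₑ ^ 2 =
      ∑' k, ENNReal.ofReal (‖c k‖ ^ 2) *
        ENNReal.ofReal (2 * (α + 1) * r * (1 - r ^ 2) ^ α * (r ^ k) ^ 2) := by
    intro r hr
    have hr2 : 0 ≤ 1 - r ^ 2 := by nlinarith [hr.1, hr.2]
    have hr0 := hr.1
    rw [lintegral_const_mul' _ _ ENNReal.ofReal_ne_top, hF.lintegral_circle hr.1.le hr.2,
      ← ENNReal.tsum_mul_left]
    refine tsum_congr fun k => ?_
    rw [← ENNReal.ofReal_mul (by positivity), ← ENNReal.ofReal_mul (by positivity)]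
    congr 1
    have := Real.pi_ne_zero
    field_simp
  rw [setLIntegral_congr_fun measurableSet_Ioo e3, lintegral_tsum]
  · refine tsum_congr fun k => ?_
    rw [lintegral_const_mul' _ _ ENNReal.ofReal_ne_top, ← ofReal_bergmanMoment hα,
      ← ENNReal.ofReal_mul (by positivity)]
  · intro k
    exact (Measurable.const_mul
      (bergmanIntegrand_continuous hα k).measurable.ennreal_ofReal _).aemeasurable

/-! ### Two-sided size of the moments -/

/-- Substitution `u = 1 - r²`, giving a Beta integral. -/
theorem bergmanMoment_eq {α : ℝ} (hα : 0 < α) (k : ℕ) :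
    bergmanMoment α k = (α + 1) * ∫ u in (0 : ℝ)..1, u ^ α * (1 - u) ^ k := by
  have hg : Continuous fun u : ℝ => u ^ α * (1 - u) ^ k :=
    (continuous_id.rpow_const fun _ => Or.inr hα.le).mul (by fun_prop)
  have h := intervalIntegral.integral_comp_mul_deriv (a := 0) (b := 1)
    (f := fun r : ℝ => 1 - r ^ 2) (f' := fun r => -(2 * r))
    (fun x _ => by simpa using (hasDerivAt_pow 2 x).const_sub 1) (by fun_prop) hg
  simp only [Function.comp_def] at h
  norm_num at h
  rw [intervalIntegral.integral_symm, ← h, neg_neg,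
    ← intervalIntegral.integral_const_mul, bergmanMoment,
    intervalIntegral.integral_of_le zero_le_one, Measure.restrict_congr_set Ioo_ae_eq_Ioc]
  refine integral_congr_ae (Filter.Eventually.of_forall fun r => ?_)
  simp only
  rw [← pow_mul, ← pow_mul, mul_comm k 2]
  ring

/-- Only `u ≤ 1/(2(k+1))` is kept; there Bernoulli's inequality gives `(1-u)^k ≥ 1/2`. -/
theorem le_bergmanMoment {α : ℝ} (hα : 0 < α) :
    ∃ C : ℝ, 0 < C ∧ ∀ k : ℕ, C * ((k : ℝ) + 1) ^ (-(α + 1)) ≤ bergmanMoment α k := by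
  refine ⟨1 / 2 * 2 ^ (-(α + 1)), by positivity, fun k => ?_⟩
  have hk : (0 : ℝ) < (k : ℝ) + 1 := by positivity
  set δ : ℝ := 1 / (2 * ((k : ℝ) + 1)) with hδ
  have hδ0 : 0 < δ := by positivity
  have hδ1 : δ ≤ 1 := by
    rw [hδ, div_le_one (by positivity)]
    linarith [Nat.cast_nonneg (α := ℝ) k]
  have hg : Continuous fun u : ℝ => u ^ α * (1 - u) ^ k :=
    (continuous_id.rpow_const fun _ => Or.inr hα.le).mul (by fun_prop)
  have h1 : ∫ u in (0 : ℝ)..δ, u ^ α * (1 / 2) ≤ ∫ u in (0 : ℝ)..δ, u ^ α * (1 - u) ^ k := by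
    refine intervalIntegral.integral_mono_on hδ0.le ?_ (hg.intervalIntegrable _ _) ?_
    · exact (Continuous.intervalIntegrable
        ((continuous_id.rpow_const fun _ => Or.inr hα.le).mul continuous_const) _ _)
    · intro u hu
      refine mul_le_mul_of_nonneg_left ?_ (Real.rpow_nonneg hu.1 _)
      have hb := one_add_mul_le_pow (a := -u) (by linarith [hu.2]) k
      have : (k : ℝ) * u ≤ 1 / 2 := by
        calc (k : ℝ) * u ≤ ((k : ℝ) + 1) * δ := by
              apply mul_le_mul (by linarith) hu.2 hu.1 hk.le
          _ = 1 / 2 := by rw [hδ]; field_simp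
      rw [sub_eq_add_neg]
      linarith
  have h2 : ∫ u in (0 : ℝ)..δ, u ^ α * (1 - u) ^ k ≤ ∫ u in (0 : ℝ)..1, u ^ α * (1 - u) ^ k := by
    refine intervalIntegral.integral_mono_interval le_rfl hδ0.le hδ1 ?_ (hg.intervalIntegrable _ _)
    filter_upwards [ae_restrict_mem measurableSet_Ioc] with u hu
    exact mul_nonneg (Real.rpow_nonneg hu.1.le _) (pow_nonneg (by linarith [hu.2]) _)
  rw [intervalIntegral.integral_mul_const, integral_rpow (Or.inl (by linarith)),
    Real.zero_rpow (by linarith), sub_zero] at h1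
  rw [bergmanMoment_eq hα]
  have h3 : δ ^ (α + 1) = 2 ^ (-(α + 1)) * ((k : ℝ) + 1) ^ (-(α + 1)) := by
    rw [hδ, one_div, Real.inv_rpow (by positivity), ← Real.rpow_neg (by positivity),
      Real.mul_rpow (by norm_num) hk.le]
  have h4 := mul_le_mul_of_nonneg_left (h1.trans h2) (by linarith : 0 ≤ α + 1)
  rw [h3] at h4
  refine le_trans (le_of_eq ?_) h4
  have : α + 1 ≠ 0 := by linarith
  field_simp

/-- On `[0,1]` one has `(1-u)^k ≤ e * exp(-(k+1)u)`, which leads to a Gamma integral. -/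
theorem bergmanMoment_le {α : ℝ} (hα : 0 < α) :
    ∃ C : ℝ, 0 < C ∧ ∀ k : ℕ, bergmanMoment α k ≤ C * ((k : ℝ) + 1) ^ (-(α + 1)) := by
  have hΓ : 0 < Real.Gamma (α + 1) := Real.Gamma_pos_of_pos (by linarith)
  refine ⟨(α + 1) * (Real.exp 1 * Real.Gamma (α + 1)), by positivity, fun k => ?_⟩
  have hk : (0 : ℝ) < (k : ℝ) + 1 := by positivity
  have hα1 : 0 < α + 1 := by linarith
  have hI := Real.integral_rpow_mul_exp_neg_mul_Ioi hα1 hk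
  simp only [add_sub_cancel_right] at hI
  have hint : IntegrableOn (fun t : ℝ => t ^ α * Real.exp (-(((k : ℝ) + 1) * t))) (Set.Ioi 0) := by
    by_contra h
    rw [integral_undef h] at hI
    have : 0 < (1 / ((k : ℝ) + 1)) ^ (α + 1) * Real.Gamma (α + 1) := by positivity
    linarith
  rw [bergmanMoment_eq hα, mul_assoc]
  refine mul_le_mul_of_nonneg_left ?_ hα1.le
  have hg : Continuous fun u : ℝ => u ^ α * (1 - u) ^ k :=
    (continuous_id.rpow_const fun _ => Or.inr hα.le).mul (by fun_prop)
  have hsub : Set.Ioc (0 : ℝ) 1 ⊆ Set.Ioi 0 := fun u hu => hu.1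
  calc ∫ u in (0 : ℝ)..1, u ^ α * (1 - u) ^ k
      = ∫ u in Set.Ioc (0 : ℝ) 1, u ^ α * (1 - u) ^ k :=
        intervalIntegral.integral_of_le zero_le_one
    _ ≤ ∫ u in Set.Ioc (0 : ℝ) 1, Real.exp 1 * (u ^ α * Real.exp (-(((k : ℝ) + 1) * u))) := by
        refine setIntegral_mono_on ?_ ((hint.mono_set hsub).const_mul _) measurableSet_Ioc ?_
        · exact (hg.integrableOn_Icc (a := 0) (b := 1)).mono_set Set.Ioc_subset_Icc_self
        · intro u hu
          rw [mul_left_comm]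
          refine mul_le_mul_of_nonneg_left ?_ (Real.rpow_nonneg hu.1.le _)
          calc (1 - u) ^ k ≤ (Real.exp (-u)) ^ k :=
                pow_le_pow_left₀ (by linarith [hu.2]) (by linarith [Real.add_one_le_exp (-u)]) _
            _ = Real.exp (-(k * u)) := by rw [← Real.exp_nat_mul]; ring_nf
            _ ≤ Real.exp 1 * Real.exp (-(((k : ℝ) + 1) * u)) := by
                rw [← Real.exp_add]
                exact Real.exp_le_exp.2 (by nlinarith [hu.2])
    _ ≤ ∫ u in Set.Ioi (0 : ℝ), Real.exp 1 * (u ^ α * Real.exp (-(((k : ℝ) + 1) * u))) := by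
        refine setIntegral_mono_set (hint.const_mul _) ?_ hsub.eventuallyLE
        filter_upwards [ae_restrict_mem measurableSet_Ioi] with u hu
        have : (0 : ℝ) ≤ u ^ α := Real.rpow_nonneg (le_of_lt hu) _
        positivity
    _ = Real.exp 1 * Real.Gamma (α + 1) * ((k : ℝ) + 1) ^ (-(α + 1)) := by
        rw [integral_const_mul, hI, one_div, Real.inv_rpow hk.le, Real.rpow_neg hk.le]
        ring

theorem bergmanMoment_pos {α : ℝ} (hα : 0 < α) (k : ℕ) : 0 < bergmanMoment α k := by
  obtain ⟨C, hC, h⟩ := le_bergmanMoment hα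
  exact lt_of_lt_of_le (by positivity) (h k)

/-! ### Norm and membership through Taylor coefficients -/

theorem eLpNorm_two_sq {μ : Measure ℂ} (f : ℂ → ℂ) :
    eLpNorm f 2 μ ^ 2 = ∫⁻ z, ‖f z‖ₑ ^ 2 ∂μ := by
  rw [eLpNorm_eq_lintegral_rpow_enorm_toReal (by norm_num) (by norm_num)]
  simp only [ENNReal.toReal_ofNat, ENNReal.rpow_ofNat]
  rw [← ENNReal.rpow_natCast, ← ENNReal.rpow_mul]
  norm_num

/-- The norm of `A²_α` in terms of Taylor coefficients. -/
theorem HasDiscSeries.hasSum_norm_sq {α : ℝ} (hα : 0 < α) {c : ℕ → ℂ} {F : ℂ → ℂ}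
    (hF : HasDiscSeries c F) (hd : DifferentiableOn ℂ F (Metric.ball 0 1))
    {f : Lp ℂ 2 (bergmanMeasure α)} (hf : (f : ℂ → ℂ) =ᵐ[bergmanMeasure α] F) :
    HasSum (fun k => ‖c k‖ ^ 2 * bergmanMoment α k) (‖f‖ ^ 2) := by
  have h1 : eLpNorm f 2 (bergmanMeasure α) ^ 2 =
      ∑' k, ENNReal.ofReal (‖c k‖ ^ 2 * bergmanMoment α k) := by
    rw [eLpNorm_congr_ae hf, eLpNorm_two_sq, hF.lintegral_bergman hα hd]
  have hnn : ∀ k, 0 ≤ ‖c k‖ ^ 2 * bergmanMoment α k := fun k =>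
    mul_nonneg (sq_nonneg _) (bergmanMoment_nonneg hα k)
  have hne : ∑' k, ENNReal.ofReal (‖c k‖ ^ 2 * bergmanMoment α k) ≠ ⊤ := by
    rw [← h1]
    exact ENNReal.pow_ne_top (Lp.eLpNorm_ne_top f)
  have hr : ∀ k, (ENNReal.ofReal (‖c k‖ ^ 2 * bergmanMoment α k)).toReal =
      ‖c k‖ ^ 2 * bergmanMoment α k := fun k => ENNReal.toReal_ofReal (hnn k)
  have h2 := ENNReal.summable_toReal hne
  simp only [hr] at h2
  have h3 : ‖f‖ ^ 2 = ∑' k, ‖c k‖ ^ 2 * bergmanMoment α k := by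
    rw [Lp.norm_def, ← ENNReal.toReal_pow, h1,
      ENNReal.tsum_toReal_eq fun k => ENNReal.ofReal_ne_top]
    simp only [hr]
  rw [h3]
  exact h2.hasSum

theorem HasDiscSeries.exists_bergmanSpace {α : ℝ} (hα : 0 < α) {c : ℕ → ℂ} {F : ℂ → ℂ}
    (hF : HasDiscSeries c F) (hd : DifferentiableOn ℂ F (Metric.ball 0 1))
    (hs : Summable fun k => ‖c k‖ ^ 2 * bergmanMoment α k) :
    ∃ f : bergmanSpace α,
      ((f : Lp ℂ 2 (bergmanMeasure α)) : ℂ → ℂ) =ᵐ[bergmanMeasure α] F := by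
  have hnn : ∀ k, 0 ≤ ‖c k‖ ^ 2 * bergmanMoment α k := fun k =>
    mul_nonneg (sq_nonneg _) (bergmanMoment_nonneg hα k)
  have hmem : MemLp F 2 (bergmanMeasure α) := by
    refine ⟨aestronglyMeasurable_bergman hd, ?_⟩
    have h1 : eLpNorm F 2 (bergmanMeasure α) ^ 2 ≠ ⊤ := by
      rw [eLpNorm_two_sq, hF.lintegral_bergman hα hd, ← ENNReal.ofReal_tsum_of_nonneg hnn hs]
      exact ENNReal.ofReal_ne_top
    exact lt_top_iff_ne_top.2 fun h => h1 (by rw [h]; rfl)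
  exact ⟨⟨hmem.toLp F, F, hd, hmem.coeFn_toLp⟩, hmem.coeFn_toLp⟩

theorem exists_hasDiscSeries {F : ℂ → ℂ} (hd : DifferentiableOn ℂ F (Metric.ball 0 1)) :
    ∃ c, HasDiscSeries c F := by
  refine ⟨fun n => ((n.factorial : ℂ))⁻¹ * iteratedDeriv n F 0, fun z hz => ?_⟩
  have := Complex.hasSum_taylorSeries_on_ball hd (z := z) (by simpa using hz)
  simp only [sub_zero, smul_eq_mul] at this
  simp only [mul_assoc, mul_comm (iteratedDeriv _ F 0)]
  exact this

theorem HasDiscSeries.sub {c d : ℕ → ℂ} {F G : ℂ → ℂ} (hF : HasDiscSeries c F)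
    (hG : HasDiscSeries d G) : HasDiscSeries (fun k => c k - d k) (F - G) := fun z hz => by
  simpa [sub_mul] using (hF z hz).sub (hG z hz)

/-! ### Taylor coefficients of the fractions -/

/-- The `m`-th power sum of the inverses of the points `a j`. -/
noncomputable def invPowerSum {n : ℕ} (a : Fin n → ℂ) (m : ℕ) : ℂ := ∑ j, (a j)⁻¹ ^ m

/-- The Taylor coefficients at `0` of `∑ j, 1 / (z - a j) ^ (M + 1)`. -/
noncomputable def fractionCoeff (M : ℕ) {n : ℕ} (a : Fin n → ℂ) (k : ℕ) : ℂ :=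
  (-1) ^ (M + 1) * ((k + M).choose M : ℂ) * invPowerSum a (k + (M + 1))

theorem hasDiscSeries_fraction (M : ℕ) {n : ℕ} {a : Fin n → ℂ} (ha : ∀ j, ‖a j‖ = 1) :
    HasDiscSeries (fractionCoeff M a) (fun z => ∑ j, 1 / (z - a j) ^ (M + 1)) := by
  intro z hz
  have h : ∀ j, HasSum (fun k => (-1) ^ (M + 1) * (a j)⁻¹ ^ (M + 1) *
      (((k + M).choose M : ℂ) * (z * (a j)⁻¹) ^ k)) (1 / (z - a j) ^ (M + 1)) := by
    intro j
    have h0 : a j ≠ 0 := norm_ne_zero_iff.1 (by rw [ha j]; exact one_ne_zero)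
    have h1 := (hasSum_choose_mul_geometric_of_norm_lt_one M (r := z * (a j)⁻¹)
      (by rw [norm_mul, norm_inv, ha j]; simpa using hz)).mul_left
      ((-1) ^ (M + 1) * (a j)⁻¹ ^ (M + 1))
    have e : 1 / (z - a j) ^ (M + 1) =
        (-1) ^ (M + 1) * (a j)⁻¹ ^ (M + 1) * (1 / (1 - z * (a j)⁻¹) ^ (M + 1)) := by
      have h2 : z - a j = (-1) * a j * (1 - z * (a j)⁻¹) := by field_simp; ring
      have h3 : 1 - z * (a j)⁻¹ ≠ 0 := by
        intro h3
        have h4 : z = a j := by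
          field_simp at h3
          linear_combination -h3
        rw [h4, ha j] at hz
        exact lt_irrefl _ hz
      rw [h2, mul_pow, mul_pow, inv_pow]
      have h5 : ((-1 : ℂ) ^ (M + 1)) * (-1) ^ (M + 1) = 1 := by rw [← mul_pow]; norm_num
      have h6 : ((-1 : ℂ) ^ (M + 1)) ≠ 0 := pow_ne_zero _ (by norm_num)
      have h7 := pow_ne_zero (M + 1) h0
      have h8 := pow_ne_zero (M + 1) h3
      generalize (-1 : ℂ) ^ (M + 1) = e at *
      generalize a j ^ (M + 1) = A at *
      generalize (1 - z * (a j)⁻¹) ^ (M + 1) = U at *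
      field_simp
      linear_combination -h5
    rw [e]
    exact h1
  have hs := hasSum_sum (s := Finset.univ) fun j _ => h j
  convert hs using 2 with k
  rw [fractionCoeff, invPowerSum, Finset.mul_sum, Finset.sum_mul]
  refine Finset.sum_congr rfl fun j _ => ?_
  rw [pow_add, mul_pow]
  ring

theorem differentiableOn_fraction (N : ℕ) {n : ℕ} {a : Fin n → ℂ} (ha : ∀ j, ‖a j‖ = 1) :
    DifferentiableOn ℂ (fun z => ∑ j, 1 / (z - a j) ^ N) (Metric.ball 0 1) := by
  refine DifferentiableOn.fun_sum fun j _ => ?_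
  refine DifferentiableOn.div (by fun_prop) (by fun_prop) fun z hz => ?_
  refine pow_ne_zero _ (sub_ne_zero.2 ?_)
  rintro rfl
  rw [mem_ball_zero_iff, ha j] at hz
  exact lt_irrefl _ hz

theorem norm_invPowerSum_le {n : ℕ} {a : Fin n → ℂ} (ha : ∀ j, ‖a j‖ = 1) (m : ℕ) :
    ‖invPowerSum a m‖ ≤ n := by
  refine (norm_sum_le _ _).trans ?_
  simp [ha]

theorem choose_add_le_pow (k M : ℕ) : (k + M).choose M ≤ (k + 1) ^ M := by
  induction M with
  | zero => simp
  | succ M ih =>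
    have h := Nat.add_one_mul_choose_eq (k + M) M
    have h2 : (k + (M + 1)).choose (M + 1) * (M + 1) ≤ (k + 1) ^ (M + 1) * (M + 1) := by
      rw [← add_assoc, ← h, pow_succ]
      calc (k + M + 1) * (k + M).choose M ≤ ((k + 1) * (M + 1)) * (k + 1) ^ M :=
            Nat.mul_le_mul (by nlinarith [Nat.zero_le (k * M)]) ih
        _ = _ := by ring
    exact Nat.le_of_mul_le_mul_right h2 (Nat.succ_pos M)

theorem pow_le_factorial_mul_choose (k M : ℕ) :
    (k + 1) ^ M ≤ M.factorial * (k + M).choose M := by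
  rw [← Nat.ascFactorial_eq_factorial_mul_choose]
  exact Nat.pow_succ_le_ascFactorial _ _

theorem pow_sq_mul_rpow (α : ℝ) (k M : ℕ) :
    (((k : ℝ) + 1) ^ M) ^ 2 * ((k : ℝ) + 1) ^ (-(α + 1)) =
      ((k : ℝ) + 1) ^ (-(α - 2 * M + 1)) := by
  have hk : (0 : ℝ) < (k : ℝ) + 1 := by positivity
  rw [← pow_mul, ← Real.rpow_natCast, ← Real.rpow_add hk]
  congr 1
  push_cast
  ring

theorem choose_sq_mul_bergmanMoment_le (M : ℕ) {α : ℝ} (hα : 0 < α) :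
    ∃ C : ℝ, 0 < C ∧ ∀ k : ℕ, ((k + M).choose M : ℝ) ^ 2 * bergmanMoment α k ≤
      C * ((k : ℝ) + 1) ^ (-(α - 2 * M + 1)) := by
  obtain ⟨C, hC, h⟩ := bergmanMoment_le hα
  refine ⟨C, hC, fun k => ?_⟩
  have h1 : ((k + M).choose M : ℝ) ≤ ((k : ℝ) + 1) ^ M := by
    exact_mod_cast choose_add_le_pow k M
  calc ((k + M).choose M : ℝ) ^ 2 * bergmanMoment α k
      ≤ (((k : ℝ) + 1) ^ M) ^ 2 * (C * ((k : ℝ) + 1) ^ (-(α + 1))) :=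
        mul_le_mul (pow_le_pow_left₀ (by positivity) h1 2) (h k) (bergmanMoment_nonneg hα k)
          (by positivity)
    _ = _ := by rw [mul_left_comm, pow_sq_mul_rpow]

theorem le_choose_sq_mul_bergmanMoment (M : ℕ) {α : ℝ} (hα : 0 < α) :
    ∃ C : ℝ, 0 < C ∧ ∀ k : ℕ, C * ((k : ℝ) + 1) ^ (-(α - 2 * M + 1)) ≤
      ((k + M).choose M : ℝ) ^ 2 * bergmanMoment α k := by
  obtain ⟨C, hC, h⟩ := le_bergmanMoment hα
  have hM : (0 : ℝ) < M.factorial := by exact_mod_cast M.factorial_pos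
  refine ⟨C / (M.factorial : ℝ) ^ 2, by positivity, fun k => ?_⟩
  have h1 : ((k : ℝ) + 1) ^ M / M.factorial ≤ ((k + M).choose M : ℝ) := by
    rw [div_le_iff₀ hM, mul_comm]
    exact_mod_cast pow_le_factorial_mul_choose k M
  calc C / (M.factorial : ℝ) ^ 2 * ((k : ℝ) + 1) ^ (-(α - 2 * M + 1))
      = (((k : ℝ) + 1) ^ M / M.factorial) ^ 2 * (C * ((k : ℝ) + 1) ^ (-(α + 1))) := by
        rw [← pow_sq_mul_rpow, div_pow]
        ring
    _ ≤ _ := mul_le_mul (pow_le_pow_left₀ (by positivity) h1 2) (h k) (by positivity)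
          (by positivity)

theorem norm_fractionCoeff_sq (M : ℕ) {n : ℕ} (a : Fin n → ℂ) (k : ℕ) :
    ‖fractionCoeff M a k‖ ^ 2 =
      ((k + M).choose M : ℝ) ^ 2 * ‖invPowerSum a (k + (M + 1))‖ ^ 2 := by
  simp [fractionCoeff, mul_pow]

theorem summable_nat_add_one_rpow {s : ℝ} (hs : 0 < s) :
    Summable fun k : ℕ => ((k : ℝ) + 1) ^ (-(s + 1)) := by
  have := (Real.summable_one_div_nat_add_rpow 1 (s + 1)).2 (by linarith)
  refine this.congr fun k => ?_
  have hk : (0 : ℝ) < (k : ℝ) + 1 := by positivity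
  rw [abs_of_pos hk, Real.rpow_neg hk.le, one_div]

theorem summable_fractionCoeff {M n : ℕ} {α : ℝ} (hα : 2 * (M : ℝ) < α) {a : Fin n → ℂ}
    (ha : ∀ j, ‖a j‖ = 1) :
    Summable fun k => ‖fractionCoeff M a k‖ ^ 2 * bergmanMoment α k := by
  have hα0 : 0 < α := lt_of_le_of_lt (by positivity) hα
  obtain ⟨C, hC, h⟩ := choose_sq_mul_bergmanMoment_le M hα0
  refine Summable.of_nonneg_of_le (fun k => mul_nonneg (sq_nonneg _) (bergmanMoment_nonneg hα0 k))
    (fun k => ?_) ((summable_nat_add_one_rpow (s := α - 2 * M) (by linarith)).mul_left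
      ((n : ℝ) ^ 2 * C))
  rw [norm_fractionCoeff_sq, mul_right_comm, mul_comm, mul_assoc]
  exact mul_le_mul (pow_le_pow_left₀ (norm_nonneg _) (norm_invPowerSum_le ha _) 2) (h k)
    (mul_nonneg (sq_nonneg _) (bergmanMoment_nonneg hα0 k)) (by positivity)

/-! ### Lower bound for the norm of a fraction -/

theorem half_le_re_inv_one_sub {w : ℂ} (hw : ‖w‖ < 1) : 1 / 2 ≤ ((1 - w)⁻¹).re := by
  have h0 : 0 < Complex.normSq (1 - w) := by
    rw [Complex.normSq_pos, sub_ne_zero]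
    rintro rfl
    simp at hw
  have h1 : Complex.normSq w ≤ 1 := by
    rw [Complex.normSq_eq_norm_sq]
    nlinarith [norm_nonneg w]
  rw [Complex.inv_re, div_le_div_iff₀ two_pos h0]
  rw [Complex.normSq_apply] at *
  simp only [Complex.sub_re, Complex.sub_im, Complex.one_re, Complex.one_im] at *
  nlinarith

/-- Positivity of the Poisson kernel gives a lower bound for the power sums. -/
theorem le_tsum_norm_invPowerSum_sq {n : ℕ} {a : Fin n → ℂ} (ha : ∀ j, ‖a j‖ = 1) {r : ℝ}
    (h0 : 0 ≤ r) (h1 : r < 1) :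
    ∃ S : ℝ, HasSum (fun m => r ^ m * ‖invPowerSum a m‖ ^ 2) S ∧ n / (1 - r) ≤ S := by
  -- Expanding `|p_m|²` over pairs `(i, j)` turns the sum over `m` into geometric series of ratio `w
  -- (i, j)`.
  set w : Fin n × Fin n → ℂ := fun p => r * ((a p.1)⁻¹ * (starRingEnd ℂ) (a p.2)⁻¹) with hw
  have hwn : ∀ p, ‖w p‖ < 1 := by
    intro p
    simp only [hw, norm_mul, norm_inv, ha, RCLike.norm_conj, Complex.norm_real,
      Real.norm_of_nonneg h0]
    simpa using h1
  have hs := hasSum_sum (s := Finset.univ) fun p (_ : p ∈ Finset.univ) =>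
    hasSum_geometric_of_norm_lt_one (hwn p)
  have hterm : ∀ m, ∑ p, w p ^ m = ((r ^ m * ‖invPowerSum a m‖ ^ 2 : ℝ) : ℂ) := by
    intro m
    rw [Complex.ofReal_mul, ← Complex.normSq_eq_norm_sq, ← Complex.mul_conj, invPowerSum, map_sum,
      Finset.sum_mul_sum, ← Finset.sum_product', Finset.univ_product_univ, Finset.mul_sum]
    refine Finset.sum_congr rfl fun p _ => ?_
    simp only [hw, mul_pow, map_pow]
    push_cast
    rfl
  simp only [hterm] at hs
  have hre := Complex.hasSum_re hs
  simp only [Complex.ofReal_re] at hre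
  refine ⟨_, hre, ?_⟩
  rw [Complex.re_sum, Fintype.sum_prod_type]
  have hdiag : ∀ i, 1 / (1 - r) ≤ ∑ j, ((1 - w (i, j))⁻¹).re := by
    intro i
    have hii : ((1 - w (i, i))⁻¹).re = 1 / (1 - r) := by
      have : w (i, i) = r := by
        simp only [hw]
        rw [Complex.mul_conj, Complex.normSq_eq_norm_sq, norm_inv, ha]
        simp
      rw [this, one_div, ← Complex.ofReal_one, ← Complex.ofReal_sub, ← Complex.ofReal_inv,
        Complex.ofReal_re]
    rw [← hii]
    exact Finset.single_le_sum (f := fun j => ((1 - w (i, j))⁻¹).re)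
      (fun j _ => le_trans (by norm_num) (half_le_re_inv_one_sub (hwn (i, j))))
      (Finset.mem_univ i)
  calc (n : ℝ) / (1 - r) = ∑ _i : Fin n, 1 / (1 - r) := by simp [div_eq_mul_inv]
    _ ≤ _ := Finset.sum_le_sum fun i _ => hdiag i

theorem exists_rpow_le_exp {q : ℝ} (hq : 0 ≤ q) :
    ∃ C : ℝ, 0 < C ∧ ∀ y : ℝ, 0 < y → y ^ q ≤ C * Real.exp y := by
  obtain ⟨Q, hQ⟩ := exists_nat_ge q
  have hf : (0 : ℝ) < Q.factorial := by exact_mod_cast Q.factorial_pos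
  refine ⟨1 + Q.factorial, by positivity, fun y hy => ?_⟩
  have h1 := Real.pow_div_factorial_le_exp y hy.le Q
  rw [div_le_iff₀ hf] at h1
  have h2 := Real.one_le_exp hy.le
  rcases le_total y 1 with h | h
  · have := Real.rpow_le_one hy.le h hq
    nlinarith
  · have := Real.rpow_le_rpow_of_exponent_le h hQ
    rw [Real.rpow_natCast] at this
    nlinarith

/-- Compares the power weight with the Abel weight `(1-δ)^k`: apply `y^q ≤ C e^y` at `y = δ(k+1)`.
-/
theorem exists_rpow_mul_pow_le {q : ℝ} (hq : 0 ≤ q) :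
    ∃ C : ℝ, 0 < C ∧ ∀ δ : ℝ, 0 < δ → δ ≤ 1 → ∀ k : ℕ,
      C * δ ^ q * (1 - δ) ^ k ≤ ((k : ℝ) + 1) ^ (-q) := by
  obtain ⟨C, hC, h⟩ := exists_rpow_le_exp hq
  refine ⟨1 / (C * Real.exp 1), by positivity, fun δ h0 h1 k => ?_⟩
  have hk : (0 : ℝ) < (k : ℝ) + 1 := by positivity
  have h2 : (1 - δ) ^ k ≤ Real.exp 1 * Real.exp (-(δ * (k + 1))) := by
    calc (1 - δ) ^ k ≤ Real.exp (-δ) ^ k :=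
          pow_le_pow_left₀ (by linarith) (by linarith [Real.add_one_le_exp (-δ)]) _
      _ = Real.exp (k * -δ) := by rw [← Real.exp_nat_mul]
      _ ≤ _ := by
        rw [← Real.exp_add]
        exact Real.exp_le_exp.2 (by nlinarith)
  have h3 := h (δ * (k + 1)) (by positivity)
  rw [Real.mul_rpow h0.le hk.le] at h3
  have h4 : δ ^ q * (1 - δ) ^ k * ((k : ℝ) + 1) ^ q ≤ C * Real.exp 1 := by
    calc δ ^ q * (1 - δ) ^ k * ((k : ℝ) + 1) ^ q = (δ ^ q * ((k : ℝ) + 1) ^ q) * (1 - δ) ^ k := by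
          ring
      _ ≤ (C * Real.exp (δ * (k + 1))) * (Real.exp 1 * Real.exp (-(δ * (k + 1)))) :=
          mul_le_mul h3 h2 (pow_nonneg (by linarith) _) (by positivity)
      _ = C * Real.exp 1 := by
          rw [Real.exp_neg]
          field_simp
  rw [Real.rpow_neg hk.le, ← one_div, le_div_iff₀ (by positivity), mul_assoc, mul_assoc,
    ← mul_assoc (δ ^ q), one_div_mul_eq_div, div_le_one (by positivity)]
  exact h4

/-- The norm of a sum of `n` fractions is at least of order `n ^ ((1 - (α - 2 M)) / 2)`. -/
theorem exists_le_norm_fraction_sq {M : ℕ} {α : ℝ} (hα : 2 * (M : ℝ) < α) :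
    ∃ C : ℝ, 0 < C ∧ ∀ n : ℕ, 1 ≤ n → ∀ a : Fin n → ℂ, (∀ j, ‖a j‖ = 1) →
      ∀ f : Lp ℂ 2 (bergmanMeasure α),
        (f : ℂ → ℂ) =ᵐ[bergmanMeasure α] (fun z => ∑ j, 1 / (z - a j) ^ (M + 1)) →
        C * (n : ℝ) ^ (1 - (α - 2 * M)) ≤ ‖f‖ ^ 2 := by
  have hα0 : 0 < α := lt_of_le_of_lt (by positivity) hα
  set q : ℝ := α - 2 * M + 1 with hq
  obtain ⟨C₁, hC₁, h₁⟩ := le_choose_sq_mul_bergmanMoment M hα0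
  obtain ⟨C₂, hC₂, h₂⟩ := exists_rpow_mul_pow_le (q := q) (by linarith)
  refine ⟨C₁ * C₂ * (1 / (2 * (M + 1))) ^ q * (M + 1), by positivity, fun n hn a ha f hf => ?_⟩
  have hn0 : (0 : ℝ) < n := by exact_mod_cast hn
  have hn1 : (1 : ℝ) ≤ n := by exact_mod_cast hn
  -- With this `δ`, `n/δ = 2(M+1)n²`, twice the bound for the `M + 1` power sums of lowest index,
  -- which do not occur as coefficients. The remaining ones thus contribute at least `(M+1)n²`.
  set δ : ℝ := 1 / (2 * (M + 1)) * (n : ℝ)⁻¹ with hδ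
  have hδ0 : 0 < δ := by positivity
  have hδ1 : δ ≤ 1 := by
    have h3 : (n : ℝ)⁻¹ ≤ 1 := inv_le_one_of_one_le₀ hn1
    have h4 : 1 / (2 * ((M : ℝ) + 1)) ≤ 1 := by
      rw [div_le_one (by positivity)]
      linarith [Nat.cast_nonneg (α := ℝ) M]
    exact mul_le_one₀ h4 (by positivity) h3
  have hsum := (hasDiscSeries_fraction M ha).hasSum_norm_sq hα0 (differentiableOn_fraction _ ha) hf
  obtain ⟨S, hS, hnS⟩ := le_tsum_norm_invPowerSum_sq ha (r := 1 - δ) (by linarith) (by linarith)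
  have hS' := (hasSum_nat_add_iff' (M + 1)).2 hS
  have hhead : ∑ i ∈ Finset.range (M + 1), (1 - δ) ^ i * ‖invPowerSum a i‖ ^ 2 ≤
      (M + 1) * (n : ℝ) ^ 2 := by
    calc _ ≤ ∑ _i ∈ Finset.range (M + 1), (n : ℝ) ^ 2 := by
          refine Finset.sum_le_sum fun i _ => ?_
          have h3 : (1 - δ) ^ i ≤ 1 := pow_le_one₀ (by linarith) (by linarith)
          have h4 := pow_le_pow_left₀ (norm_nonneg _) (norm_invPowerSum_le ha i) 2
          calc _ ≤ 1 * ‖invPowerSum a i‖ ^ 2 := mul_le_mul_of_nonneg_right h3 (by positivity)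
            _ ≤ _ := by rwa [one_mul]
      _ = _ := by simp
  have hSn : 2 * ((M : ℝ) + 1) * (n : ℝ) ^ 2 ≤ S := by
    refine le_trans (le_of_eq ?_) hnS
    rw [sub_sub_cancel, hδ]
    field_simp
  have hcomp := hasSum_le (fun k => ?_) (hS'.mul_left (C₁ * C₂ * δ ^ q)) hsum
  · refine le_trans ?_ hcomp
    have h5 : C₁ * C₂ * (1 / (2 * ((M : ℝ) + 1))) ^ q * (M + 1) * (n : ℝ) ^ (1 - (α - 2 * M)) =
        C₁ * C₂ * δ ^ q * ((M + 1) * (n : ℝ) ^ 2) := by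
      have h6 : (n : ℝ) ^ (1 - (α - 2 * M)) = (n : ℝ)⁻¹ ^ q * (n : ℝ) ^ 2 := by
        rw [Real.inv_rpow hn0.le, ← Real.rpow_neg hn0.le, ← Real.rpow_natCast _ 2,
          ← Real.rpow_add hn0]
        congr 1
        rw [hq]
        push_cast
        ring
      rw [hδ, Real.mul_rpow (by positivity) (by positivity), h6]
      ring
    rw [h5]
    exact mul_le_mul_of_nonneg_left (by linarith) (by positivity)
  · rw [norm_fractionCoeff_sq]
    have h7 : (1 - δ) ^ (k + (M + 1)) ≤ (1 - δ) ^ k :=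
      pow_le_pow_of_le_one (by linarith) (by linarith) (by omega)
    calc C₁ * C₂ * δ ^ q * ((1 - δ) ^ (k + (M + 1)) * ‖invPowerSum a (k + (M + 1))‖ ^ 2)
        ≤ C₁ * C₂ * δ ^ q * ((1 - δ) ^ k * ‖invPowerSum a (k + (M + 1))‖ ^ 2) :=
          mul_le_mul_of_nonneg_left (mul_le_mul_of_nonneg_right h7 (by positivity)) (by positivity)
      _ = C₁ * (C₂ * δ ^ q * (1 - δ) ^ k) * ‖invPowerSum a (k + (M + 1))‖ ^ 2 := by ring
      _ ≤ C₁ * ((k : ℝ) + 1) ^ (-q) * ‖invPowerSum a (k + (M + 1))‖ ^ 2 :=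
          mul_le_mul_of_nonneg_right
            (mul_le_mul_of_nonneg_left (h₂ δ hδ0 hδ1 k) hC₁.le) (by positivity)
      _ ≤ ((k + M).choose M : ℝ) ^ 2 * bergmanMoment α k *
            ‖invPowerSum a (k + (M + 1))‖ ^ 2 :=
          mul_le_mul_of_nonneg_right (h₁ k) (by positivity)
      _ = _ := by ring

/-! ### Failure of density up to the critical exponent -/

theorem hasDiscSeries_monomial (c : ℂ) (k : ℕ) :
    HasDiscSeries (fun i => if i = k then c else 0) (fun z => c * z ^ k) := fun z _ => by
  have : HasSum (fun i => (if i = k then c else 0) * z ^ i)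
      ((if k = k then c else 0) * z ^ k) :=
    hasSum_single k (by intro i hi; simp [hi])
  simpa using this

theorem mem_bergmanFractions_iff {N : ℕ} {α : ℝ} {f : bergmanSpace α} :
    f ∈ bergmanFractions N α ↔ ∃ n : ℕ, 1 ≤ n ∧ ∃ a : Fin n → ℂ, (∀ j, ‖a j‖ = 1) ∧
      ((f : Lp ℂ 2 (bergmanMeasure α)) : ℂ → ℂ) =ᵐ[bergmanMeasure α]
        (fun z => ∑ j, 1 / (z - a j) ^ N) := by
  constructor
  · rintro ⟨g, ⟨n, hn, a, ha, rfl⟩, hf⟩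
    exact ⟨n, hn, a, fun j => by simpa using ha j, hf⟩
  · rintro ⟨n, hn, a, ha, hf⟩
    exact ⟨_, ⟨n, hn, a, fun j => by simpa using ha j, rfl⟩, hf⟩

theorem exists_bergmanSpace_fraction {M n : ℕ} {α : ℝ} (hα : 2 * (M : ℝ) < α) {a : Fin n → ℂ}
    (ha : ∀ j, ‖a j‖ = 1) :
    ∃ f : bergmanSpace α, ((f : Lp ℂ 2 (bergmanMeasure α)) : ℂ → ℂ) =ᵐ[bergmanMeasure α]
      (fun z => ∑ j, 1 / (z - a j) ^ (M + 1)) :=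
  (hasDiscSeries_fraction M ha).exists_bergmanSpace (lt_of_le_of_lt (by positivity) hα)
    (differentiableOn_fraction _ ha) (summable_fractionCoeff hα ha)

theorem not_dense_bergmanFractions (M : ℕ) :
    ¬ Dense (bergmanFractions (M + 1) (2 * (M : ℝ) + 1)) := by
  obtain ⟨C, hC, h⟩ := exists_le_norm_fraction_sq (M := M) (α := 2 * (M : ℝ) + 1) (by linarith)
  intro hd
  obtain ⟨f, hf, hfC⟩ := Metric.dense_iff.1 hd 0 (Real.sqrt C) (Real.sqrt_pos.2 hC)
  obtain ⟨n, hn, a, ha, hfa⟩ := mem_bergmanFractions_iff.1 hfC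
  have h1 := h n hn a ha f hfa
  rw [show 1 - (2 * (M : ℝ) + 1 - 2 * M) = 0 by ring, Real.rpow_zero, mul_one] at h1
  rw [mem_ball_zero_iff, Real.lt_sqrt (norm_nonneg _)] at hf
  exact absurd h1 (not_le.2 hf)

theorem exists_nat_bound_of_rpow_le {C p R : ℝ} (hC : 0 < C) (hp : 0 < p) :
    ∃ B : ℝ, 0 ≤ B ∧ ∀ n : ℕ, C * (n : ℝ) ^ p ≤ R → (n : ℝ) ≤ B := by
  have h := ((tendsto_rpow_atTop hp).const_mul_atTop hC).eventually_gt_atTop R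
  obtain ⟨B, hB⟩ := Filter.eventually_atTop.1 h
  refine ⟨max B 0, le_max_right _ _, fun n hn => ?_⟩
  by_contra! hlt
  exact absurd hn (not_le.2 (hB n ((le_max_left _ _).trans hlt.le)))

theorem tendsto_nat_add_one_rpow {s : ℝ} (hs : 0 < s) (A : ℝ) :
    Filter.Tendsto (fun k : ℕ => A * ((k : ℝ) + 1) ^ (-s)) Filter.atTop (nhds 0) := by
  have h := (tendsto_rpow_neg_atTop hs).comp
    (Filter.tendsto_atTop_add_const_right _ 1 tendsto_natCast_atTop_atTop)
  simpa [Function.comp_def] using h.const_mul A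

theorem exists_monomial_of_norm {α : ℝ} (hα : 0 < α) (k : ℕ) {ρ : ℝ} (hρ : 0 ≤ ρ) :
    ∃ (e : bergmanSpace α) (c : ℂ), ‖e‖ = ρ ∧ ‖c‖ ^ 2 * bergmanMoment α k = ρ ^ 2 ∧
      ((e : Lp ℂ 2 (bergmanMeasure α)) : ℂ → ℂ) =ᵐ[bergmanMeasure α] fun z => c * z ^ k := by
  have hω0 := bergmanMoment_pos hα k
  set c : ℂ := ((ρ * (Real.sqrt (bergmanMoment α k))⁻¹ : ℝ) : ℂ) with hc
  have hcω : ‖c‖ ^ 2 * bergmanMoment α k = ρ ^ 2 := by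
    rw [hc, Complex.norm_real, Real.norm_eq_abs, sq_abs, mul_pow, inv_pow, Real.sq_sqrt hω0.le,
      mul_assoc, inv_mul_cancel₀ hω0.ne', mul_one]
  have hmon := hasDiscSeries_monomial c k
  have hmond : DifferentiableOn ℂ (fun z : ℂ => c * z ^ k) (Metric.ball 0 1) := by fun_prop
  obtain ⟨e, he⟩ := hmon.exists_bergmanSpace hα hmond
    (summable_of_ne_finset_zero (s := {k}) (by
      intro i hi
      rw [Finset.mem_singleton] at hi
      simp [hi]))
  refine ⟨e, c, ?_, hcω, he⟩
  have h2 := (hmon.hasSum_norm_sq hα hmond he).unique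
    (hasSum_single k (by intro i hi; simp [hi]))
  rw [if_pos rfl, hcω] at h2
  exact (pow_left_inj₀ (norm_nonneg e) hρ two_ne_zero).1 h2

theorem norm_sq_le_of_sub_sub (p p' c : ℂ) :
    ‖c‖ ^ 2 ≤ 2 * ‖p' - p - c‖ ^ 2 + 4 * (‖p‖ ^ 2 + ‖p'‖ ^ 2) := by
  have h4 : ‖c‖ ≤ ‖p' - p - c‖ + (‖p'‖ + ‖p‖) := by
    have h5 := norm_sub_le (p' - p) (p' - p - c)
    rw [sub_sub_cancel] at h5
    linarith [norm_sub_le p' p]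
  nlinarith [sq_nonneg (‖p' - p - c‖ - (‖p'‖ + ‖p‖)), sq_nonneg (‖p'‖ - ‖p‖), norm_nonneg c]

theorem fractionCoeff_sq_mul_le {M : ℕ} {α C B : ℝ} {k : ℕ}
    (h : ((k + M).choose M : ℝ) ^ 2 * bergmanMoment α k ≤
      C * ((k : ℝ) + 1) ^ (-(α - 2 * M + 1))) (hα : 0 < α)
    {n : ℕ} {a : Fin n → ℂ} (hB : ‖invPowerSum a (k + (M + 1))‖ ≤ B) :
    ‖fractionCoeff M a k‖ ^ 2 * bergmanMoment α k ≤
      B ^ 2 * C * ((k : ℝ) + 1) ^ (-(α - 2 * M + 1)) := by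
  rw [norm_fractionCoeff_sq, mul_right_comm, mul_comm, mul_assoc]
  exact mul_le_mul (pow_le_pow_left₀ (norm_nonneg _) hB 2) h
    (mul_nonneg (sq_nonneg _) (bergmanMoment_nonneg hα k)) (by positivity)

/-- A difference of two sums of fractions has `k`-th coefficient of bounded size, hence stays away
from the monomials of large degree. -/
theorem norm_sq_monomial_le {M : ℕ} {α : ℝ} (hα : 0 < α) {n n' : ℕ} {a : Fin n → ℂ}
    {a' : Fin n' → ℂ} (ha : ∀ j, ‖a j‖ = 1) (ha' : ∀ j, ‖a' j‖ = 1)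
    {g g' e : Lp ℂ 2 (bergmanMeasure α)}
    (hg : (g : ℂ → ℂ) =ᵐ[bergmanMeasure α]
      (fun z => ∑ j, 1 / (z - a j) ^ (M + 1)))
    (hg' : (g' : ℂ → ℂ) =ᵐ[bergmanMeasure α]
      (fun z => ∑ j, 1 / (z - a' j) ^ (M + 1))) {c : ℂ} {k : ℕ}
    (he : (e : ℂ → ℂ) =ᵐ[bergmanMeasure α] fun z => c * z ^ k) :
    ‖c‖ ^ 2 * bergmanMoment α k ≤ 2 * ‖g' - g - e‖ ^ 2 +
      4 * (‖fractionCoeff M a k‖ ^ 2 * bergmanMoment α k +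
        ‖fractionCoeff M a' k‖ ^ 2 * bergmanMoment α k) := by
  have hmond : DifferentiableOn ℂ (fun z : ℂ => c * z ^ k) (Metric.ball 0 1) := by fun_prop
  have hser := ((hasDiscSeries_fraction M ha').sub (hasDiscSeries_fraction M ha)).sub
    (hasDiscSeries_monomial c k)
  have hdiff := ((differentiableOn_fraction (M + 1) ha').sub
    (differentiableOn_fraction (M + 1) ha)).sub hmond
  have hrep := (Lp.coeFn_sub (g' - g) e).trans (((Lp.coeFn_sub g' g).trans (hg'.sub hg)).sub he)
  have hterm := le_hasSum (hser.hasSum_norm_sq hα hdiff hrep) k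
    (fun i _ => mul_nonneg (sq_nonneg _) (bergmanMoment_nonneg hα i))
  rw [if_pos rfl] at hterm
  have h3 := mul_le_mul_of_nonneg_right
    (norm_sq_le_of_sub_sub (fractionCoeff M a k) (fractionCoeff M a' k) c)
    (bergmanMoment_nonneg hα k)
  linarith

/-- If the closure contained a ball about `x`, both `x` and `x + e`, with `e` a monomial of norm
`r/2`, would be limits of fractions with at most `B` poles. The `k`-th coefficients of these are
negligible for large `k`. -/
theorem isNowhereDense_bergmanFractions {M : ℕ} {α : ℝ} (hα : 2 * (M : ℝ) < α)
    (hα' : α < 2 * (M : ℝ) + 1) : IsNowhereDense (bergmanFractions (M + 1) α) := by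
  have hα0 : 0 < α := lt_of_le_of_lt (by positivity) hα
  obtain ⟨C, hC, h⟩ := exists_le_norm_fraction_sq hα
  obtain ⟨C', hC', h'⟩ := choose_sq_mul_bergmanMoment_le M hα0
  rw [IsNowhereDense, Set.eq_empty_iff_forall_notMem]
  intro x hx
  obtain ⟨r, hr, hball⟩ := Metric.isOpen_iff.1 isOpen_interior x hx
  have hcl : Metric.ball x r ⊆ closure (bergmanFractions (M + 1) α) :=
    hball.trans interior_subset
  obtain ⟨B, hB0, hB⟩ := exists_nat_bound_of_rpow_le (R := (‖x‖ + r) ^ 2) hC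
    (by linarith : 0 < 1 - (α - 2 * M))
  -- The threshold `r²/64` yields the contradiction `r²/4 < 2(r/4)² + 4 * 2 * r²/64 = r²/4`.
  have hev := (tendsto_nat_add_one_rpow (s := α - 2 * M + 1) (by linarith)
    (B ^ 2 * C')).eventually_lt_const (by positivity : 0 < r ^ 2 / 64)
  obtain ⟨k, hk⟩ := hev.exists
  obtain ⟨e, c, hner, hcω, he⟩ := exists_monomial_of_norm hα0 k (by positivity : 0 ≤ r / 2)
  have hx0 := hcl (Metric.mem_ball_self hr)
  have hx1 : x + e ∈ closure (bergmanFractions (M + 1) α) := by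
    refine hcl ?_
    rw [mem_ball_iff_norm, add_sub_cancel_left, hner]
    linarith
  obtain ⟨g, hg, hgx⟩ := Metric.mem_closure_iff.1 hx0 (r / 8) (by positivity)
  obtain ⟨g', hg', hgx'⟩ := Metric.mem_closure_iff.1 hx1 (r / 8) (by positivity)
  rw [dist_eq_norm] at hgx hgx'
  obtain ⟨n, hn, a, ha, hga⟩ := mem_bergmanFractions_iff.1 hg
  obtain ⟨n', hn', a', ha', hga'⟩ := mem_bergmanFractions_iff.1 hg'
  have hgn : ‖g‖ ≤ ‖x‖ + r := by
    have := norm_sub_le x (x - g)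
    rw [sub_sub_cancel] at this
    linarith
  have hgn' : ‖g'‖ ≤ ‖x‖ + r := by
    have h1 := norm_sub_le (x + e) (x + e - g')
    have h2 := norm_add_le x e
    rw [sub_sub_cancel] at h1
    linarith
  have hnB : (n : ℝ) ≤ B := hB n ((h n hn a ha g hga).trans
    (pow_le_pow_left₀ (norm_nonneg _) hgn 2))
  have hnB' : (n' : ℝ) ≤ B := hB n' ((h n' hn' a' ha' g' hga').trans
    (pow_le_pow_left₀ (norm_nonneg _) hgn' 2))
  have h1 := fractionCoeff_sq_mul_le (h' k) hα0 ((norm_invPowerSum_le ha _).trans hnB)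
  have h2 := fractionCoeff_sq_mul_le (h' k) hα0 ((norm_invPowerSum_le ha' _).trans hnB')
  have h3 : ‖c‖ ^ 2 * bergmanMoment α k ≤ 2 * ‖g' - g - e‖ ^ 2 +
      4 * (‖fractionCoeff M a k‖ ^ 2 * bergmanMoment α k +
        ‖fractionCoeff M a' k‖ ^ 2 * bergmanMoment α k) :=
    norm_sq_monomial_le hα0 ha ha' hga hga' he
  have hD : ‖g' - g - e‖ ≤ r / 4 := by
    have h4 : g' - g - e = (x - g) - (x + e - g') := by abel
    rw [h4]
    exact (norm_sub_le _ _).trans (by linarith)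
  have hD2 := pow_le_pow_left₀ (norm_nonneg _) hD 2
  rw [hcω] at h3
  linarith

/-! ### Perturbed roots of unity and density -/

/-- `∑_{j < n} e^{2 π i l j / n}`. -/
noncomputable def rootSum (n : ℕ) (l : ℤ) : ℂ :=
  ∑ j : Fin n, Complex.exp (l * (2 * Real.pi * (j : ℕ) / n * Complex.I))

theorem norm_exp_int_mul_root (n : ℕ) (l : ℤ) (j : ℕ) :
    ‖Complex.exp (l * (2 * Real.pi * (j : ℕ) / n * Complex.I))‖ = 1 := by
  have := Complex.norm_exp_ofReal_mul_I (l * (2 * Real.pi * (j : ℕ) / n))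
  push_cast at this
  rwa [mul_assoc] at this

theorem norm_rootSum_le (n : ℕ) (l : ℤ) : ‖rootSum n l‖ ≤ n := by
  refine (norm_sum_le _ _).trans ?_
  simp [norm_exp_int_mul_root]

theorem rootSum_zero (n : ℕ) : rootSum n 0 = n := by simp [rootSum]

theorem rootSum_eq_zero {n : ℕ} {l : ℤ} (h : ¬ (n : ℤ) ∣ l) : rootSum n l = 0 := by
  rcases Nat.eq_zero_or_pos n with rfl | hn
  · simp [rootSum]
  have hn0 : (n : ℂ) ≠ 0 := by exact_mod_cast hn.ne'
  set z : ℂ := Complex.exp (l * (2 * Real.pi / n * Complex.I)) with hz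
  have h1 : rootSum n l = ∑ j ∈ Finset.range n, z ^ j := by
    rw [rootSum, ← Fin.sum_univ_eq_sum_range (fun j => z ^ j)]
    refine Finset.sum_congr rfl fun j _ => ?_
    rw [hz, ← Complex.exp_nat_mul]
    congr 1
    ring
  have hzn : z ^ n = 1 := by
    rw [hz, ← Complex.exp_nat_mul, Complex.exp_eq_one_iff]
    exact ⟨l, by field_simp⟩
  have hz1 : z ≠ 1 := by
    rw [hz, Ne, Complex.exp_eq_one_iff]
    rintro ⟨m, hm⟩
    apply h
    refine ⟨m, ?_⟩
    have hpi : (Real.pi : ℂ) ≠ 0 := by exact_mod_cast Real.pi_ne_zero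
    have h2 : (l : ℂ) = n * m := by
      field_simp at hm
      linear_combination hm
    exact_mod_cast h2
  rw [h1, geom_sum_eq hz1, hzn, sub_self, zero_div]

theorem not_dvd_of_abs_lt {n : ℕ} {l : ℤ} (h0 : l ≠ 0) (h : |l| < n) : ¬ (n : ℤ) ∣ l := by
  intro hd
  exact h0 (Int.eq_zero_of_abs_lt_dvd hd h)

/-- The real trigonometric polynomial `2 Re ∑_{p < L} d_p e^{i p t}`. -/
noncomputable def realTrigPoly (d : ℕ → ℂ) (L : ℕ) (t : ℝ) : ℝ :=
  ∑ p ∈ Finset.range L, 2 * (d p * Complex.exp (p * (t * Complex.I))).re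

theorem ofReal_realTrigPoly (d : ℕ → ℂ) (L : ℕ) (t : ℝ) :
    (realTrigPoly d L t : ℂ) = ∑ p ∈ Finset.range L, (d p * Complex.exp (p * (t * Complex.I)) +
      (starRingEnd ℂ) (d p) * Complex.exp (-p * (t * Complex.I))) := by
  rw [realTrigPoly, Complex.ofReal_sum]
  refine Finset.sum_congr rfl fun p _ => ?_
  rw [← Complex.add_conj, map_mul, ← Complex.exp_conj]
  simp

theorem abs_realTrigPoly_le (d : ℕ → ℂ) (L : ℕ) (t : ℝ) :
    |realTrigPoly d L t| ≤ ∑ p ∈ Finset.range L, 2 * ‖d p‖ := by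
  refine (Finset.abs_sum_le_sum_abs _ _).trans (Finset.sum_le_sum fun p _ => ?_)
  rw [abs_mul, abs_two]
  refine mul_le_mul_of_nonneg_left ((Complex.abs_re_le_norm _).trans ?_) two_pos.le
  have : ‖Complex.exp (p * (t * Complex.I))‖ = 1 := by
    have := Complex.norm_exp_ofReal_mul_I (p * t)
    push_cast at this
    rwa [mul_assoc] at this
  rw [norm_mul, this, mul_one]

/-- The `n`-th roots of unity, with arguments moved by `u / n`. -/
noncomputable def perturbedRoots (u : ℝ → ℝ) (n : ℕ) (j : Fin n) : ℂ :=
  Complex.exp (((2 * Real.pi * (j : ℕ) / n + u (2 * Real.pi * (j : ℕ) / n) / n : ℝ) : ℂ) *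
    Complex.I)

theorem norm_perturbedRoots (u : ℝ → ℝ) (n : ℕ) (j : Fin n) : ‖perturbedRoots u n j‖ = 1 :=
  Complex.norm_exp_ofReal_mul_I _

theorem invPowerSum_perturbedRoots (u : ℝ → ℝ) (n m : ℕ) :
    invPowerSum (perturbedRoots u n) m = rootSum n (-m) +
      ∑ j : Fin n, Complex.exp ((-m : ℤ) * (2 * Real.pi * (j : ℕ) / n * Complex.I)) *
        (Complex.exp (Complex.I * ((-(m * u (2 * Real.pi * (j : ℕ) / n) / n) : ℝ) : ℂ)) - 1) := by
  rw [invPowerSum, rootSum, ← Finset.sum_add_distrib]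
  refine Finset.sum_congr rfl fun j _ => ?_
  rw [perturbedRoots, ← Complex.exp_neg, ← Complex.exp_nat_mul, mul_sub, mul_one,
    add_sub_cancel, ← Complex.exp_add]
  congr 1
  push_cast
  ring

/-- The bound is uniform in `n`: the unperturbed sum vanishes unless `n ∣ m`, and then `n ≤ m`; each
of the `n` perturbations costs at most `mU/n`. -/
theorem norm_invPowerSum_perturbedRoots_le {u : ℝ → ℝ} {U : ℝ} (hu : ∀ t, |u t| ≤ U)
    {n m : ℕ} (hm : 1 ≤ m) : ‖invPowerSum (perturbedRoots u n) m‖ ≤ m * (1 + U) := by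
  have hU : 0 ≤ U := (abs_nonneg _).trans (hu 0)
  rcases Nat.eq_zero_or_pos n with rfl | hn
  · simp only [invPowerSum, Finset.univ_eq_empty, Finset.sum_empty, norm_zero]
    positivity
  have hn0 : (0 : ℝ) < n := by exact_mod_cast hn
  rw [invPowerSum_perturbedRoots, mul_add, mul_one]
  refine (norm_add_le _ _).trans (add_le_add ?_ ?_)
  · by_cases h : (n : ℤ) ∣ -m
    · refine (norm_rootSum_le _ _).trans ?_
      have h1 : n ∣ m := by
        rw [dvd_neg] at h
        exact_mod_cast h
      exact_mod_cast Nat.le_of_dvd hm h1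
    · rw [rootSum_eq_zero h, norm_zero]
      positivity
  · calc _ ≤ ∑ _j : Fin n, (m * U / n : ℝ) := by
          refine (norm_sum_le _ _).trans (Finset.sum_le_sum fun j _ => ?_)
          rw [norm_mul, norm_exp_int_mul_root, one_mul]
          refine Real.norm_exp_I_mul_ofReal_sub_one_le.trans ?_
          rw [norm_neg, norm_div, norm_mul, Real.norm_natCast, Real.norm_natCast]
          have := hu (2 * Real.pi * (j : ℕ) / n)
          gcongr
          exact this
      _ = m * U := by
          simp
          field_simp

/-- Discrete orthogonality: `L + m < n` excludes aliasing, and `m ≥ 1` removes the conjugate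
frequencies. -/
theorem sum_exp_mul_realTrigPoly (d : ℕ → ℂ) (L : ℕ) {n m : ℕ} (hm : 1 ≤ m) (hn : L + m < n) :
    ∑ j : Fin n, Complex.exp ((-m : ℤ) * (2 * Real.pi * (j : ℕ) / n * Complex.I)) *
      (realTrigPoly d L (2 * Real.pi * (j : ℕ) / n) : ℂ) = n * if m < L then d m else 0 := by
  have h1 : ∑ j : Fin n, Complex.exp ((-m : ℤ) * (2 * Real.pi * (j : ℕ) / n * Complex.I)) *
      (realTrigPoly d L (2 * Real.pi * (j : ℕ) / n) : ℂ) =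
      ∑ p ∈ Finset.range L, (d p * rootSum n (p - m) +
        (starRingEnd ℂ) (d p) * rootSum n (-p - m)) := by
    simp only [ofReal_realTrigPoly, Finset.mul_sum]
    rw [Finset.sum_comm]
    refine Finset.sum_congr rfl fun p _ => ?_
    rw [rootSum, rootSum, Finset.mul_sum, Finset.mul_sum, ← Finset.sum_add_distrib]
    refine Finset.sum_congr rfl fun j _ => ?_
    rw [mul_add, mul_left_comm _ (d p), mul_left_comm _ ((starRingEnd ℂ) (d p)),
      ← Complex.exp_add, ← Complex.exp_add]
    push_cast
    congr 3 <;> ring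
  have h2 : ∀ p ∈ Finset.range L, d p * rootSum n (p - m) +
      (starRingEnd ℂ) (d p) * rootSum n (-p - m) = if p = m then n * d m else 0 := by
    intro p hp
    have hp' := Finset.mem_range.1 hp
    rw [rootSum_eq_zero (l := -p - m) (not_dvd_of_abs_lt (by omega) (by
      rw [abs_lt]; constructor <;> omega)), mul_zero, add_zero]
    split_ifs with h
    · subst h
      rw [sub_self, rootSum_zero, mul_comm]
    · rw [rootSum_eq_zero (not_dvd_of_abs_lt (by omega) (by
        rw [abs_lt]; constructor <;> omega)), mul_zero]
  rw [h1, Finset.sum_congr rfl h2, Finset.sum_ite_eq']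
  simp only [Finset.mem_range, mul_ite, mul_zero]

/-- Linearise `e^x - 1`: the first-order part is already equal to the limit for large `n`, and the
`n` quadratic errors total at most `(mU)²/n`. -/
theorem tendsto_invPowerSum_perturbedRoots (d : ℕ → ℂ) (L : ℕ) {m : ℕ} (hm : 1 ≤ m) :
    Filter.Tendsto (fun n => invPowerSum (perturbedRoots (realTrigPoly d L) n) m) Filter.atTop
      (nhds (-(Complex.I * m) * if m < L then d m else 0)) := by
  set U := ∑ p ∈ Finset.range L, 2 * ‖d p‖ with hU
  have hu := abs_realTrigPoly_le d L
  rw [← hU] at hu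
  have hU0 : 0 ≤ U := (abs_nonneg _).trans (hu 0)
  rw [tendsto_iff_norm_sub_tendsto_zero]
  refine squeeze_zero' (Filter.Eventually.of_forall fun n => norm_nonneg _) ?_
    (tendsto_const_div_atTop_nhds_zero_nat ((m * U) ^ 2))
  have hlarge : ∀ᶠ n : ℕ in Filter.atTop, (m * U : ℝ) ≤ n :=
    tendsto_natCast_atTop_atTop.eventually_ge_atTop _
  filter_upwards [hlarge, Filter.eventually_gt_atTop (L + m)] with n hn1 hn2
  have hn : 0 < n := by omega
  have hn0 : (0 : ℝ) < n := by exact_mod_cast hn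
  have hn0' : (n : ℂ) ≠ 0 := by exact_mod_cast hn.ne'
  rw [invPowerSum_perturbedRoots, rootSum_eq_zero (not_dvd_of_abs_lt (by omega) (by
    rw [abs_lt]; constructor <;> omega)), zero_add]
  have hmain : -(Complex.I * m) * (if m < L then d m else 0) = ∑ j : Fin n,
      Complex.exp ((-m : ℤ) * (2 * Real.pi * (j : ℕ) / n * Complex.I)) *
        (Complex.I *
          ((-(m * realTrigPoly d L (2 * Real.pi * (j : ℕ) / n) / n) : ℝ) : ℂ)) := by
    have h1 := sum_exp_mul_realTrigPoly d L hm hn2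
    calc _ = (-(Complex.I * m) / n) * (n * if m < L then d m else 0) := by field_simp
      _ = _ := by
        rw [← h1, Finset.mul_sum]
        refine Finset.sum_congr rfl fun j _ => ?_
        push_cast
        ring
  rw [hmain, ← Finset.sum_sub_distrib]
  calc _ ≤ ∑ _j : Fin n, ((m * U / n) ^ 2 : ℝ) := by
        refine (norm_sum_le _ _).trans (Finset.sum_le_sum fun j _ => ?_)
        rw [← mul_sub, norm_mul, norm_exp_int_mul_root, one_mul]
        set x : ℂ := Complex.I *
          ((-(m * realTrigPoly d L (2 * Real.pi * (j : ℕ) / n) / n) : ℝ) : ℂ) with hx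
        have hxn : ‖x‖ ≤ m * U / n := by
          rw [hx, norm_mul, Complex.norm_I, one_mul, Complex.norm_real, norm_neg, norm_div,
            norm_mul, Real.norm_natCast, Real.norm_natCast]
          have := hu (2 * Real.pi * (j : ℕ) / n)
          gcongr
          exact this
        have hx1 : m * U / n ≤ 1 := by rwa [div_le_one hn0]
        exact (Complex.norm_exp_sub_one_sub_id_le (hxn.trans hx1)).trans
          (pow_le_pow_left₀ (norm_nonneg _) hxn 2)
    _ = (m * U) ^ 2 / n := by
        simp
        field_simp

/-- Any finite segment of coefficients can be approximated by those of sums of fractions, with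
power sums growing at most linearly. -/
theorem exists_tendsto_fractionCoeff (M K : ℕ) (c : ℕ → ℂ) :
    ∃ (a : (n : ℕ) → Fin n → ℂ) (B : ℝ), (∀ n j, ‖a n j‖ = 1) ∧ 0 ≤ B ∧
      (∀ n k, ‖invPowerSum (a n) (k + (M + 1))‖ ≤ B * ((k : ℝ) + 1)) ∧
      ∀ k, Filter.Tendsto (fun n => fractionCoeff M (a n) k) Filter.atTop
        (nhds (if k < K then c k else 0)) := by
  -- Chosen to solve `(-1)^(M+1) * choose (k+M) M * (-i m d_m) = c_k` at `m = k + M + 1`, the only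
  -- indices where `d` matters for the limits.
  set d : ℕ → ℂ := fun m => (-1) ^ (M + 1) * c (m - (M + 1)) /
    ((m - 1).choose M * -(Complex.I * m)) with hd
  set u := realTrigPoly d (K + (M + 1)) with hu
  set U := ∑ p ∈ Finset.range (K + (M + 1)), 2 * ‖d p‖ with hU
  have hU0 : 0 ≤ U := Finset.sum_nonneg fun p _ => by positivity
  refine ⟨perturbedRoots u, (M + 1) * (1 + U), norm_perturbedRoots u, by positivity,
    fun n k => ?_, fun k => ?_⟩
  · refine (norm_invPowerSum_perturbedRoots_le (abs_realTrigPoly_le d _) (by omega)).trans ?_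
    rw [mul_right_comm]
    refine mul_le_mul_of_nonneg_right ?_ (by positivity)
    push_cast
    nlinarith [Nat.cast_nonneg (α := ℝ) k, Nat.cast_nonneg (α := ℝ) M,
      mul_nonneg (Nat.cast_nonneg (α := ℝ) k) (Nat.cast_nonneg (α := ℝ) M)]
  · have h := (tendsto_invPowerSum_perturbedRoots d (K + (M + 1))
      (m := k + (M + 1)) (by omega)).const_mul ((-1) ^ (M + 1) * ((k + M).choose M : ℂ))
    refine (congrArg (fun z => Filter.Tendsto _ Filter.atTop (nhds z)) ?_).mp h
    simp only [add_lt_add_iff_right]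
    split_ifs with hk
    · have h1 : ((k + M).choose M : ℂ) ≠ 0 := by
        exact_mod_cast (Nat.choose_pos (by omega : M ≤ k + M)).ne'
      have h2 : ((k + (M + 1) : ℕ) : ℂ) ≠ 0 := by exact_mod_cast (by omega : k + (M + 1) ≠ 0)
      have h3 : ((-1 : ℂ) ^ (M + 1)) * (-1) ^ (M + 1) = 1 := by rw [← mul_pow]; norm_num
      have h4 : k + (M + 1) - 1 = k + M := by omega
      simp only [hd, Nat.add_sub_cancel, h4]
      have h5 : -(Complex.I * ((k + (M + 1) : ℕ) : ℂ)) ≠ 0 :=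
        neg_ne_zero.2 (mul_ne_zero Complex.I_ne_zero h2)
      generalize -(Complex.I * ((k + (M + 1) : ℕ) : ℂ)) = w at *
      generalize (-1 : ℂ) ^ (M + 1) = s at *
      field_simp
      linear_combination c k * h3
    · simp

theorem dense_bergmanFractions {M : ℕ} {α : ℝ} (hα : 2 * (M : ℝ) + 2 < α) :
    Dense (bergmanFractions (M + 1) α) := by
  have hα1 : 2 * (M : ℝ) < α := by linarith
  have hα0 : 0 < α := lt_of_le_of_lt (by positivity) hα1
  have hω := bergmanMoment_nonneg hα0
  obtain ⟨C, hC, hCk⟩ := choose_sq_mul_bergmanMoment_le M hα0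
  rw [Metric.dense_iff]
  intro x ε hε
  obtain ⟨F, hF, hxF⟩ := x.2
  obtain ⟨c, hc⟩ := exists_hasDiscSeries hF
  have hcs := (hc.hasSum_norm_sq hα0 hF hxF).summable
  obtain ⟨K, hK⟩ := ((tendsto_sum_nat_add
    (fun k => ‖c k‖ ^ 2 * bergmanMoment α k)).eventually_lt_const
      (by positivity : 0 < ε ^ 2)).exists
  obtain ⟨a, B, ha, hB0, hB, hlim⟩ := exists_tendsto_fractionCoeff M K c
  -- The linear growth of the power sums costs two powers of `k + 1`; summability is where `α > 2M +
  -- 2` enters.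
  have hbound : Summable fun k : ℕ => 2 * (‖c k‖ ^ 2 * bergmanMoment α k) +
      2 * (B ^ 2 * C * ((k : ℝ) + 1) ^ (-((α - 2 * M - 2) + 1))) :=
    (hcs.mul_left 2).add
      (((summable_nat_add_one_rpow (by linarith)).mul_left (B ^ 2 * C)).mul_left 2)
  have hT := tendsto_tsum_of_dominated_convergence (𝓕 := Filter.atTop)
    (f := fun n k => ‖c k - fractionCoeff M (a n) k‖ ^ 2 * bergmanMoment α k)
    (g := fun k => ‖c k - if k < K then c k else 0‖ ^ 2 * bergmanMoment α k) hbound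
    (fun k => (((tendsto_const_nhds.sub (hlim k)).norm.pow 2).mul_const _))
    (Filter.Eventually.of_forall fun n k => by
      rw [Real.norm_of_nonneg (mul_nonneg (sq_nonneg _) (hω k))]
      have h1 := fractionCoeff_sq_mul_le (hCk k) hα0 (hB n k)
      have h2 : (B * ((k : ℝ) + 1)) ^ 2 * C * ((k : ℝ) + 1) ^ (-(α - 2 * M + 1)) =
          B ^ 2 * C * ((k : ℝ) + 1) ^ (-((α - 2 * M - 2) + 1)) := by
        have hk : (0 : ℝ) < (k : ℝ) + 1 := by positivity
        have h3 : (-((α - 2 * M - 2) + 1) : ℝ) = -(α - 2 * M + 1) + (2 : ℕ) := by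
          push_cast
          ring
        rw [h3, Real.rpow_add hk, Real.rpow_natCast]
        ring
      rw [h2] at h1
      have h4 : ‖c k - fractionCoeff M (a n) k‖ ^ 2 ≤
          2 * ‖c k‖ ^ 2 + 2 * ‖fractionCoeff M (a n) k‖ ^ 2 := by
        nlinarith [norm_sub_le (c k) (fractionCoeff M (a n) k),
          norm_nonneg (c k - fractionCoeff M (a n) k),
          sq_nonneg (‖c k‖ - ‖fractionCoeff M (a n) k‖)]
      have h5 := mul_le_mul_of_nonneg_right h4 (hω k)
      linarith)
  -- The limiting error is the tail of `x` beyond degree `K`, which is below `ε²` by the choice of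
  -- `K`.
  have htail : ∑' k, ‖c k - if k < K then c k else 0‖ ^ 2 * bergmanMoment α k =
      ∑' k, ‖c (k + K)‖ ^ 2 * bergmanMoment α (k + K) := by
    have hs : Summable fun k =>
        ‖c k - if k < K then c k else 0‖ ^ 2 * bergmanMoment α k := by
      refine Summable.of_nonneg_of_le (fun k => mul_nonneg (sq_nonneg _) (hω k)) (fun k => ?_) hcs
      split_ifs
      · simpa using mul_nonneg (sq_nonneg ‖c k‖) (hω k)
      · rw [sub_zero]
    rw [← hs.sum_add_tsum_nat_add K, Finset.sum_eq_zero, zero_add]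
    · simp
    · intro k hk
      simp [Finset.mem_range.1 hk]
  rw [htail] at hT
  obtain ⟨n, hn, hn1⟩ := ((hT.eventually_lt_const hK).and (Filter.eventually_ge_atTop 1)).exists
  obtain ⟨g, hg⟩ := exists_bergmanSpace_fraction hα1 (ha n)
  refine ⟨g, ?_, mem_bergmanFractions_iff.2 ⟨n, hn1, a n, ha n, hg⟩⟩
  have hdist := ((hc.sub (hasDiscSeries_fraction M (ha n))).hasSum_norm_sq hα0
    (hF.sub (differentiableOn_fraction _ (ha n)))
    ((Lp.coeFn_sub (x : Lp ℂ 2 (bergmanMeasure α)) g).trans (hxF.sub hg))).tsum_eq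
  rw [hdist] at hn
  rw [mem_ball_iff_norm']
  exact lt_of_pow_lt_pow_left₀ 2 hε.le hn

theorem theorem1p7 (N : ℕ) (hN : 2 ≤ N) :
    -- for `α > 2 (N - 1)`, every element of `SF^N(𝕋)` belongs to `A²_α`
    (∀ α : ℝ, 2 * ((N : ℝ) - 1) < α →
      ∀ g ∈ simplePartialFractions N (Metric.sphere (0 : ℂ) 1),
        ∃ f : bergmanSpace α,
          ((f : Lp ℂ 2 (bergmanMeasure α)) : ℂ → ℂ) =ᵐ[bergmanMeasure α] g) ∧
    (∀ α : ℝ, 2 * ((N : ℝ) - 1) < α → α < criticalExponent N →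
      IsNowhereDense (bergmanFractions N α)) ∧
    ¬ Dense (bergmanFractions N (criticalExponent N)) ∧
    (∀ α : ℝ, criticalExponent N + 1 < α → Dense (bergmanFractions N α)) := by
  obtain ⟨M, rfl⟩ : ∃ M, N = M + 1 := ⟨N - 1, by omega⟩
  have hM : ((M + 1 : ℕ) : ℝ) - 1 = M := by push_cast; ring
  rw [criticalExponent, hM]
  refine ⟨?_, fun α h1 h2 => isNowhereDense_bergmanFractions h1 h2, not_dense_bergmanFractions M,
    fun α h => dense_bergmanFractions (by linarith)⟩
  rintro α hα g ⟨n, -, a, ha, rfl⟩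
  exact exists_bergmanSpace_fraction hα fun j => by simpa using ha j
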